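/- For sets $A,B\subseteq\mathbb N$ write $A\le_{\mathrm{lex}}B$ if $A=B$ or the least element of the symmetric difference of $A$ and $B$ belongs to $B$. A set $A\subseteq\mathbb N$ is \emph{left-r.e.} if it is the pointwise limit of a uniformly recursive sequence of sets $A_0,A_1,\ldots$ with $A_s\le_{\mathrm{lex}}A_{s+1}$ for all $s$. A \emph{left-r.e. numbering} is a map $\alpha: e\mapsto\alpha_e\subseteq\mathbb N$ for which there are sets $\alpha_{e,s}$ such that the $\{0,1\}$-valued map $(e,s,n)\mapsto\alpha_{e,s}(n)$ is recursive, $\alpha_{e,s}\le_{\mathrm{lex}}\alpha_{e,s+1}$ for all $e,s$, and $\alpha_e=\lim_{s\to\infty}\alpha_{e,s}$ (pointwise) for all $e$. It is \emph{universal} if every left-r.e. set equals $\alpha_e$ for some $e$. \textbf{Theorem.} There exists a universal left-r.e. numbering $\alpha$ such that $$\mathrm{LEX}_\alpha=\{\langle i,j\rangle : \alpha_i\le_{\mathrm{lex}}\alpha_j\}$$ is an r.e. relation on $\mathbb N$. -/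

import Mathlib

open Filter

/-- The lexicographic order on sets of natural numbers: `A = B`, or the least element of the
symmetric difference of `A` and `B` belongs to `B`. -/
def LexLE (A B : Set ℕ) : Prop :=
  A = B ∨ ∃ x, IsLeast (symmDiff A B) x ∧ x ∈ B

/-- `A` is left-r.e.: there is a uniformly recursive sequence `A_0, A_1, …` (given by the
characteristic functions `a s`), nondecreasing for `LexLE`, which converges pointwise to `A`. -/
def IsLeftRE (A : Set ℕ) : Prop :=
  ∃ a : ℕ → ℕ → Bool,
    Computable (fun p : ℕ × ℕ => a p.1 p.2) ∧
    (∀ s, LexLE {n | a s n = true} {n | a (s + 1) n = true}) ∧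
    ∀ n, ∀ᶠ s in atTop, (a s n = true ↔ n ∈ A)

/-- `α` is a left-r.e. numbering: `α e` is the pointwise limit, as `s` tends to infinity, of
sets `α_{e,s}` whose characteristic functions are recursive uniformly in `e`, `s`, and which
are nondecreasing in `s` for `LexLE`. -/
def IsLeftRENumbering (α : ℕ → Set ℕ) : Prop :=
  ∃ a : ℕ → ℕ → ℕ → Bool,
    Computable (fun p : ℕ × ℕ × ℕ => a p.1 p.2.1 p.2.2) ∧
    (∀ e s, LexLE {n | a e s n = true} {n | a e (s + 1) n = true}) ∧
    ∀ e n, ∀ᶠ s in atTop, (a e s n = true ↔ n ∈ α e)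

/-- A left-r.e. numbering is universal if its range includes all left-r.e. sets. -/
def IsUniversalLeftRENumbering (α : ℕ → Set ℕ) : Prop :=
  IsLeftRENumbering α ∧ ∀ A : Set ℕ, IsLeftRE A → ∃ e, α e = A

/-- The relation `LEX_α`, consisting of the pairs `(i, j)` with `α i ≤_lex α j`. -/
def LEX (α : ℕ → Set ℕ) : Set (ℕ × ℕ) :=
  {p | LexLE (α p.1) (α p.2)}

/-! Running all programs yields nondecreasing sequences `approx e` of finite sequences whose limits
include every left-r.e. set. Their limits need not be comparable in an r.e. way, so they are
rearranged by a priority construction. Each index carries a value that follows some `approx e`;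
smaller rank means higher priority. When the followers of `e` move up to the current target, every
value in the interval crossed is swept along. Hence an inequality between two values, once present,
persists (`val_succ_le_val_succ`). If moreover indices with equal limits eventually have equal
values (`eventually_val_eq`), then `valLimit i ≤ valLimit j` can be recognised at a finite stage
(`valLimit_le_iff`).

Ranks do not increase once an index is in use, so each index ends up constant or permanently
following one `e`. A constant limit has finite support and is attained by any nondecreasing sequence
tending to it. Followers of the same `e` always coincide. Permanent followers of `d < e` and `e`
have different limits: `e` is blocked, and its followers frozen, whenever a follower of `d` agrees
with the target of `e` up to the length attached to the follower of `e`.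

For universality, take the least `e` with a given limit and suppose that no index has this limit.
Late on, `e` is blocked only through a short length or by its own frozen entries. Followers created
later have large lengths and lie strictly above those frozen entries, so one of them would be
permanent. Thus from some stage on there are none, no further entries of `e` are frozen, and the
finitely many old ones are eventually not crossed; the next attempt then succeeds, a contradiction.
-/

/-- Characteristic functions of sets of natural numbers, ordered lexicographically. -/
abbrev LexSeq := Lex (ℕ → Bool)

/-! ### Lexicographic order, common prefixes and pointwise limits. -/

namespace LexSeq

theorem lt_iff {x y : LexSeq} :
    x < y ↔ ∃ i, (∀ j < i, x j = y j) ∧ x i = false ∧ y i = true := by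
  have h : x < y ↔ ∃ i, (∀ j < i, x j = y j) ∧ x i < y i := Iff.rfl
  simp only [h, Bool.lt_iff]

/-- `x` and `y` have the same first `n` terms. -/
def AgreeBelow (n : ℕ) (x y : LexSeq) : Prop := ∀ i < n, x i = y i

theorem AgreeBelow.symm {n : ℕ} {x y : LexSeq} (h : AgreeBelow n x y) : AgreeBelow n y x :=
  fun i hi => (h i hi).symm

theorem AgreeBelow.trans {n : ℕ} {x y z : LexSeq} (h : AgreeBelow n x y)
    (h' : AgreeBelow n y z) : AgreeBelow n x z :=
  fun i hi => (h i hi).trans (h' i hi)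

theorem AgreeBelow.mono {m n : ℕ} {x y : LexSeq} (h : AgreeBelow n x y) (hmn : m ≤ n) :
    AgreeBelow m x y :=
  fun i hi => h i (hi.trans_le hmn)

theorem lt_of_agreeBelow {n : ℕ} {x y x' y' : LexSeq} (hx : AgreeBelow n x x')
    (hy : AgreeBelow n y y') (h : x < y) (hn : ¬ AgreeBelow n x y) : x' < y' := by
  obtain ⟨i, hi, h0, h1⟩ := lt_iff.1 h
  have hin : i < n := by
    by_contra hc
    exact hn fun j hj => hi j (by omega)
  refine lt_iff.2 ⟨i, fun j hj => ?_, ?_, ?_⟩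
  · rw [← hx j (hj.trans hin), ← hy j (hj.trans hin), hi j hj]
  · rw [← hx i hin, h0]
  · rw [← hy i hin, h1]

/-- Sets of sequences with a given prefix are order convex. This is how agreement passes from the
two ends of a move to everything crossed. -/
theorem AgreeBelow.of_le_of_le {n : ℕ} {x y z : LexSeq} (hxy : x ≤ y) (hyz : y ≤ z)
    (h : AgreeBelow n x z) : AgreeBelow n x y := by
  by_contra hc
  have hlt : x < y := lt_of_le_of_ne hxy fun he => hc (he ▸ fun _ _ => rfl)
  exact absurd hyz (not_le.2 (lt_of_agreeBelow h (fun _ _ => rfl) hlt hc))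

theorem le_of_forall_agreeBelow {x y : LexSeq}
    (h : ∀ n, ∃ x' y', AgreeBelow n x x' ∧ AgreeBelow n y y' ∧ x' ≤ y') : x ≤ y := by
  by_contra hc
  obtain ⟨i, hi, h0, h1⟩ := lt_iff.1 (not_le.1 hc)
  obtain ⟨x', y', hx, hy, hle⟩ := h (i + 1)
  refine absurd hle (not_le.2 (lt_of_agreeBelow hy hx (not_le.1 hc) fun hn => ?_))
  have := hn i (by omega)
  simp_all

/-- Pointwise convergence. -/
def ConvergesTo (u : ℕ → LexSeq) (x : LexSeq) : Prop := ∀ n, ∀ᶠ s in atTop, u s n = x n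

theorem ConvergesTo.agreeBelow {u : ℕ → LexSeq} {x : LexSeq} (h : ConvergesTo u x) (n : ℕ) :
    ∀ᶠ s in atTop, AgreeBelow n (u s) x := by
  induction n with
  | zero => exact Eventually.of_forall fun s i hi => absurd hi (by omega)
  | succ n ih =>
    filter_upwards [ih, h n] with s h1 h2 i hi
    rcases Nat.lt_succ_iff_lt_or_eq.1 hi with hi | rfl
    exacts [h1 i hi, h2]

theorem convergesTo_of_agreeBelow {u : ℕ → LexSeq} {x : LexSeq}
    (h : ∀ n, ∀ᶠ s in atTop, AgreeBelow n (u s) x) : ConvergesTo u x := fun n => by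
  filter_upwards [h (n + 1)] with s hs
  exact hs n (by omega)

theorem ConvergesTo.le {u v : ℕ → LexSeq} {x y : LexSeq} (hu : ConvergesTo u x)
    (hv : ConvergesTo v y) (h : ∀ᶠ s in atTop, u s ≤ v s) : x ≤ y := by
  refine le_of_forall_agreeBelow fun n => ?_
  obtain ⟨s, h1, h2, h3⟩ := ((hu.agreeBelow n).and ((hv.agreeBelow n).and h)).exists
  exact ⟨u s, v s, h1.symm, h2.symm, h3⟩

theorem convergesTo_const (x : LexSeq) : ConvergesTo (fun _ => x) x :=
  fun _ => Eventually.of_forall fun _ => rfl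

theorem ConvergesTo.unique {u : ℕ → LexSeq} {x y : LexSeq} (hu : ConvergesTo u x)
    (hv : ConvergesTo u y) : x = y := by
  funext n
  obtain ⟨s, h1, h2⟩ := ((hu n).and (hv n)).exists
  exact h1.symm.trans h2

theorem ConvergesTo.eq_of_eventually_eq {u : ℕ → LexSeq} {x y : LexSeq} (hu : ConvergesTo u x)
    (h : ∀ᶠ s in atTop, u s = y) : x = y := by
  funext n
  obtain ⟨s, h1, h2⟩ := ((hu n).and h).exists
  rw [← h1, h2]

theorem ConvergesTo.le_limit {u : ℕ → LexSeq} {x : LexSeq} (hm : Monotone u)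
    (hu : ConvergesTo u x) (s : ℕ) : u s ≤ x :=
  (convergesTo_const (u s)).le hu ((eventually_ge_atTop s).mono fun _ h => hm h)

theorem ConvergesTo.eventually_lt {u : ℕ → LexSeq} {x y : LexSeq}
    (hu : ConvergesTo u x) (h : y < x) : ∀ᶠ s in atTop, y < u s := by
  obtain ⟨i, hi, h0, h1⟩ := lt_iff.1 h
  filter_upwards [hu.agreeBelow (i + 1)] with s hs
  refine lt_of_agreeBelow (fun _ _ => rfl) hs.symm h fun hn => ?_
  have := hn i (by omega)
  simp_all

/-- Once the first `n` terms are final, monotonicity lets term `n` change only from 0 to 1, hence at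
most once. -/
theorem exists_convergesTo {u : ℕ → LexSeq} (hm : Monotone u) : ∃ x, ConvergesTo u x := by
  have key : ∀ n, ∃ N, ∀ s ≥ N, AgreeBelow n (u N) (u s) := by
    intro n
    induction n with
    | zero => exact ⟨0, fun s _ i hi => absurd hi (by omega)⟩
    | succ n ih =>
      obtain ⟨N, hN⟩ := ih
      by_cases h : ∃ M ≥ N, u M n = true
      · obtain ⟨M, hM, ht⟩ := h
        refine ⟨M, fun s hs i hi => ?_⟩
        have hag : AgreeBelow n (u M) (u s) := (hN M hM).symm.trans (hN s (le_trans hM hs))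
        rcases Nat.lt_succ_iff_lt_or_eq.1 hi with hi | rfl
        · exact hag i hi
        · rw [ht]
          by_contra hc
          refine absurd (hm hs) (not_le.2 (lt_iff.2 ⟨i, fun j hj => (hag j hj).symm, ?_, ht⟩))
          simpa using hc
      · push Not at h
        refine ⟨N, fun s hs i hi => ?_⟩
        rcases Nat.lt_succ_iff_lt_or_eq.1 hi with hi | rfl
        · exact hN s hs i hi
        · have h1 := h N le_rfl
          have h2 := h s hs
          simp_all
  choose N hN using key
  refine ⟨fun n => u (N (n + 1)) n, fun n => ?_⟩
  filter_upwards [eventually_ge_atTop (N (n + 1))] with s hs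
  exact (hN (n + 1) s hs n (by omega)).symm

theorem lexLE_iff {x y : LexSeq} : LexLE {n | x n = true} {n | y n = true} ↔ x ≤ y := by
  have hmem : ∀ n, n ∈ symmDiff {n | x n = true} {n | y n = true} ↔ x n ≠ y n := by
    intro n
    simp only [Set.mem_symmDiff, Set.mem_ofPred_eq]
    cases x n <;> cases y n <;> simp
  constructor
  · rintro (h | ⟨i, ⟨hi, hl⟩, hy⟩)
    · refine le_of_eq (funext fun n => ?_)
      exact Bool.eq_iff_iff.2 (Set.ext_iff.1 h n)
    · refine le_of_lt (lt_iff.2 ⟨i, fun j hj => ?_, ?_, hy⟩)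
      · by_contra hc
        exact absurd (hl ((hmem j).2 hc)) (by omega)
      · have h1 := (hmem i).1 hi
        have h2 : y i = true := hy
        simpa [h2] using h1
  · intro h
    rcases h.eq_or_lt with rfl | h
    · exact Or.inl rfl
    · obtain ⟨i, hi, h0, h1⟩ := lt_iff.1 h
      refine Or.inr ⟨i, ⟨(hmem i).2 (by simp [h0, h1]), fun j hj => ?_⟩, h1⟩
      by_contra hc
      exact (hmem j).1 hj (hi j (by omega))

/-! ### Finitely supported sequences. -/

/-- The sequence which begins with `l` and continues with zeros. -/
def ofList (l : List Bool) : LexSeq := toLex fun n => l.getD n false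

theorem ofList_apply (l : List Bool) (n : ℕ) : ofList l n = l.getD n false := rfl

theorem ofList_nil_le (x : LexSeq) : ofList [] ≤ x := by
  by_contra h
  obtain ⟨i, -, -, h1⟩ := lt_iff.1 (not_le.1 h)
  simp [ofList_apply] at h1

/-- Continuing with zeros gives the least sequence with a given prefix. -/
theorem le_of_agreeBelow_ofList {l : List Bool} {y : LexSeq}
    (h : AgreeBelow l.length (ofList l) y) : ofList l ≤ y := by
  by_contra hc
  obtain ⟨i, hi, h0, h1⟩ := lt_iff.1 (not_le.1 hc)
  rcases lt_or_ge i l.length with hl | hl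
  · have := h i hl
    simp_all
  · rw [ofList_apply, List.getD_eq_default _ _ hl] at h1
    simp at h1

/-- A nondecreasing sequence with a finitely supported limit attains it. -/
theorem ConvergesTo.eventually_eq_ofList {u : ℕ → LexSeq} (hm : Monotone u) {l : List Bool}
    (hu : ConvergesTo u (ofList l)) : ∀ᶠ s in atTop, u s = ofList l := by
  filter_upwards [hu.agreeBelow l.length] with s hs
  exact le_antisymm (hu.le_limit hm s) (le_of_agreeBelow_ofList hs.symm)

/-- The inequality can fail only at a 1 of `l`, that is, below its length. This bounds all
quantifiers and makes the order primitive recursive. -/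
theorem ofList_le_ofList_iff {l m : List Bool} : ofList l ≤ ofList m ↔
    ∀ i < l.length, l.getD i false = true →
      m.getD i false = true ∨ ∃ j < i, l.getD j false = false ∧ m.getD j false = true := by
  constructor
  · intro h i _ hl
    by_contra hc
    push Not at hc
    obtain ⟨h1, h2⟩ := hc
    have hlt : ofList m < ofList l := by
      by_contra hge
      rcases (not_lt.1 hge).eq_or_lt with he | hlt
      · exact h1 ((congrFun he i).symm.trans hl)
      · obtain ⟨j, hj, h3, h4⟩ := lt_iff.1 hlt
        rcases lt_trichotomy j i with hji | rfl | hji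
        · exact h2 j hji h3 h4
        · exact h1 h4
        · exact h1 ((hj i hji).symm.trans hl)
    exact absurd h (not_le.2 hlt)
  · intro h
    by_contra hc
    obtain ⟨i, hi, h0, h1⟩ := lt_iff.1 (not_le.1 hc)
    have hil : i < l.length := by
      by_contra hl
      rw [ofList_apply, List.getD_eq_default _ _ (not_lt.1 hl)] at h1
      simp at h1
    rcases h i hil h1 with h2 | ⟨j, hj, h2, h3⟩
    · exact absurd (h0.symm.trans h2) (by simp)
    · have := hi j hj
      rw [ofList_apply, ofList_apply, h2, h3] at this
      simp at this

/-! ### Primitive recursiveness of comparisons between finite sequences. -/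

theorem _root_.PrimrecRel.exists_lt_comp {β : Type*} [Primcodable β] {R : ℕ → β → Prop}
    (h : PrimrecRel R) : PrimrecRel fun n y => ∃ x < n, R x y :=
  PrimrecPred.of_eq (h.exists_mem_list.comp (Primrec.list_range.comp Primrec.fst) Primrec.snd)
    fun q => by simp

theorem _root_.PrimrecRel.forall_lt_comp {β : Type*} [Primcodable β] {R : ℕ → β → Prop}
    (h : PrimrecRel R) : PrimrecRel fun n y => ∀ x < n, R x y :=
  PrimrecPred.of_eq (h.forall_mem_list.comp (Primrec.list_range.comp Primrec.fst) Primrec.snd)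
    fun q => by simp

theorem primrec_getD : Primrec₂ fun (l : List Bool) (n : ℕ) => l.getD n false :=
  Primrec.list_getD false

theorem primrecRel_ofList_le : PrimrecRel fun l m : List Bool => ofList l ≤ ofList m := by
  have hg {γ : Type} [Primcodable γ] {f : γ → List Bool} {g : γ → ℕ} (hf : Primrec f)
      (hg : Primrec g) (b : Bool) : PrimrecPred fun c => (f c).getD (g c) false = b :=
    Primrec.eq.comp (primrec_getD.comp hf hg) (Primrec.const b)
  have h1 : PrimrecRel fun (j : ℕ) (q : List Bool × List Bool) =>
      q.1.getD j false = false ∧ q.2.getD j false = true :=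
    (hg (Primrec.fst.comp Primrec.snd) Primrec.fst false).and
      (hg (Primrec.snd.comp Primrec.snd) Primrec.fst true)
  have h2 : PrimrecRel fun (i : ℕ) (q : List Bool × List Bool) =>
      (¬ q.1.getD i false = true) ∨ (q.2.getD i false = true ∨
        ∃ j < i, q.1.getD j false = false ∧ q.2.getD j false = true) :=
    (hg (Primrec.fst.comp Primrec.snd) Primrec.fst true).not.or
      ((hg (Primrec.snd.comp Primrec.snd) Primrec.fst true).or
        (h1.exists_lt_comp.comp Primrec.fst Primrec.snd))
  have h3 : PrimrecPred fun q : List Bool × List Bool => _ :=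
    h2.forall_lt_comp.comp (Primrec.list_length.comp Primrec.fst) Primrec.id
  refine PrimrecPred.of_eq h3 fun q => ?_
  refine Iff.trans ?_ ofList_le_ofList_iff.symm
  simp only [imp_iff_not_or, id]

theorem primrecPred_agreeBelow :
    PrimrecPred fun q : ℕ × List Bool × List Bool =>
      AgreeBelow q.1 (ofList q.2.1) (ofList q.2.2) := by
  have h : PrimrecRel fun (i : ℕ) (q : List Bool × List Bool) =>
      q.1.getD i false = q.2.getD i false :=
    Primrec.eq.comp (primrec_getD.comp (Primrec.fst.comp Primrec.snd) Primrec.fst)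
      (primrec_getD.comp (Primrec.snd.comp Primrec.snd) Primrec.fst)
  exact h.forall_lt_comp.comp Primrec.fst Primrec.snd

end LexSeq

/-! ### Approximations to all left-r.e. sets. -/

namespace LeftRE
open LexSeq Nat.Partrec

/-- The value which code number `e` outputs on the first component of `s` within as many steps as
the second component says; the empty list if there is none. -/
def candidate (e s : ℕ) : List Bool :=
  ((Code.evaln s.unpair.2 (Denumerable.ofNat Code e) s.unpair.1).bind
    (Encodable.decode (α := List Bool))).getD []

open Classical in
/-- The lexicographic maximum of the first `s` candidates. -/
noncomputable def approx (e : ℕ) : ℕ → List Bool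
  | 0 => []
  | s + 1 => if ofList (approx e s) ≤ ofList (candidate e s) then candidate e s else approx e s

theorem primrec_candidate : Primrec₂ candidate := by
  have h1 : Primrec fun q : ℕ × ℕ => q.2.unpair := Primrec.unpair.comp Primrec.snd
  have h2 : Primrec fun q : ℕ × ℕ =>
      Code.evaln q.2.unpair.2 (Denumerable.ofNat Code q.1) q.2.unpair.1 :=
    Code.primrec_evaln.comp (((Primrec.snd.comp h1).pair
      ((Primrec.ofNat Code).comp Primrec.fst)).pair (Primrec.fst.comp h1))
  exact Primrec.option_getD.comp
    (Primrec.option_bind h2 (Primrec.decode.comp Primrec.snd).to₂) (Primrec.const [])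

theorem primrec_approx : Primrec₂ approx := by
  classical
  have hc : Primrec fun q : ℕ × ℕ × List Bool => candidate q.1 q.2.1 :=
    primrec_candidate.comp Primrec.fst (Primrec.fst.comp Primrec.snd)
  have hp : Primrec fun q : ℕ × ℕ × List Bool => q.2.2 := Primrec.snd.comp Primrec.snd
  have hstep : Primrec₂ fun (e : ℕ) (q : ℕ × List Bool) =>
      if ofList q.2 ≤ ofList (candidate e q.1) then candidate e q.1 else q.2 :=
    Primrec.ite (primrecRel_ofList_le.comp hp hc) hc hp
  refine (Primrec.nat_rec (Primrec.const []) hstep).of_eq fun e s => ?_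
  induction s with
  | zero => rfl
  | succ s ih => simp only [approx, ← ih]

theorem approx_le_succ (e s : ℕ) : ofList (approx e s) ≤ ofList (approx e (s + 1)) := by
  rw [approx]
  split_ifs with h
  exacts [h, le_rfl]

theorem candidate_le_approx (e s : ℕ) : ofList (candidate e s) ≤ ofList (approx e (s + 1)) := by
  rw [approx]
  split_ifs with h
  exacts [le_rfl, (not_le.1 h).le]

theorem approx_monotone (e : ℕ) : Monotone fun s => ofList (approx e s) :=
  monotone_nat_of_le_succ (approx_le_succ e)

theorem approx_le_of_candidate_le {e : ℕ} {x : LexSeq} (h : ∀ s, ofList (candidate e s) ≤ x)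
    (s : ℕ) : ofList (approx e s) ≤ x := by
  induction s with
  | zero => exact ofList_nil_le x
  | succ s ih =>
    rw [approx]
    split_ifs
    exacts [h s, ih]

/-- The list of the first `n` values of `f`. -/
def initialValues (f : ℕ → Bool) (n : ℕ) : List Bool := (List.range n).map f

theorem initialValues_apply (f : ℕ → Bool) (n i : ℕ) :
    ofList (initialValues f n) i = if i < n then f i else false := by
  rw [ofList_apply, initialValues]
  split_ifs with h
  · simp [List.getD_eq_getElem?_getD, h]
  · exact List.getD_eq_default _ _ (by simpa using h)

theorem initialValues_le (f : ℕ → Bool) (n : ℕ) : ofList (initialValues f n) ≤ toLex f := by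
  refine le_of_agreeBelow_ofList fun i hi => ?_
  have hi : i < n := by simpa [initialValues] using hi
  rw [initialValues_apply, if_pos hi]
  rfl

theorem computable_initialValues {a : ℕ → ℕ → Bool}
    (ha : Computable fun p : ℕ × ℕ => a p.1 p.2) :
    Computable fun t => initialValues (a t) t := by
  have hterm : Computable fun q : ℕ × ℕ × List Bool => a q.1 q.2.1 :=
    Computable.comp (f := fun p : ℕ × ℕ => a p.1 p.2) (g := fun q : ℕ × ℕ × List Bool =>
      (q.1, q.2.1)) ha (Computable.fst.pair (Computable.fst.comp Computable.snd))
  have hstep : Computable₂ fun (t : ℕ) (q : ℕ × List Bool) => q.2 ++ [a t q.1] :=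
    Computable.list_concat.comp (Computable.snd.comp Computable.snd) hterm
  have hrec := Computable.nat_rec (f := fun t : ℕ => t) (g := fun _ : ℕ => ([] : List Bool))
    (h := fun t q => q.2 ++ [a t q.1]) Computable.id (Computable.const []) hstep
  have : ∀ t n, Nat.rec (motive := fun _ => List Bool) [] (fun y IH => IH ++ [a t y]) n
      = initialValues (a t) n := by
    intro t n
    induction n with
    | zero => rfl
    | succ n ih => simp only [ih, initialValues, List.range_succ, List.map_append, List.map_cons,
        List.map_nil]
  exact hrec.of_eq fun t => this t t

/-- Every left-r.e. set is the limit of one of the sequences of approximations. -/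
theorem exists_approx_convergesTo {A : Set ℕ} (hA : IsLeftRE A) :
    ∃ e x, ConvergesTo (fun s => ofList (approx e s)) x ∧ {n | x n = true} = A := by
  classical
  obtain ⟨a, hcomp, hmono, hlim⟩ := hA
  have hm : Monotone fun s => (toLex (a s) : LexSeq) :=
    monotone_nat_of_le_succ fun s => lexLE_iff.1 (hmono s)
  let x : LexSeq := toLex fun n => decide (n ∈ A)
  have hx : ConvergesTo (fun s => toLex (a s)) x := fun n => by
    filter_upwards [hlim n] with s hs
    exact Bool.eq_iff_iff.2 (hs.trans (decide_eq_true_iff).symm)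
  -- The program chosen outputs on `t` the first `t` terms of `a t`. These prefixes lie below the
  -- limit, and so does the empty default value.
  have hpart : Nat.Partrec fun t => Part.some (Encodable.encode (initialValues (a t) t)) :=
    Partrec.nat_iff.1 (Computable.encode.comp (computable_initialValues hcomp))
  obtain ⟨c, hc⟩ := Code.exists_code.1 hpart
  have hcand : ∀ s, candidate (Encodable.encode c) s = [] ∨
      candidate (Encodable.encode c) s = initialValues (a s.unpair.1) s.unpair.1 := by
    intro s
    rw [candidate, Denumerable.ofNat_encode]
    cases h : Code.evaln s.unpair.2 c s.unpair.1 with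
    | none => exact Or.inl rfl
    | some y =>
      have := Code.evaln_sound h
      rw [hc] at this
      have hy : y = _ := Part.mem_some_iff.1 this
      right
      simp [hy]
  have hle : ∀ s, ofList (candidate (Encodable.encode c) s) ≤ x := by
    intro s
    rcases hcand s with h | h
    · rw [h]
      exact ofList_nil_le x
    · rw [h]
      exact (initialValues_le _ _).trans (hx.le_limit hm _)
  have hattain : ∀ t, ∃ s, candidate (Encodable.encode c) s = initialValues (a t) t := by
    intro t
    have : Encodable.encode (initialValues (a t) t) ∈ Code.eval c t := by
      rw [hc]
      exact Part.mem_some _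
    obtain ⟨k, hk⟩ := Code.evaln_complete.1 this
    refine ⟨Nat.pair t k, ?_⟩
    rw [candidate, Denumerable.ofNat_encode, Nat.unpair_pair, Option.mem_def.1 hk]
    simp
  refine ⟨Encodable.encode c, x, convergesTo_of_agreeBelow fun n => ?_, ?_⟩
  · obtain ⟨t, ht, hnt⟩ := ((hx.agreeBelow n).and (eventually_ge_atTop n)).exists
    obtain ⟨s, hs⟩ := hattain t
    filter_upwards [eventually_ge_atTop (s + 1)] with r hr
    have h1 : ofList (initialValues (a t) t) ≤ ofList (approx (Encodable.encode c) r) :=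
      hs ▸ (candidate_le_approx _ s).trans (approx_monotone _ hr)
    have h2 := approx_le_of_candidate_le hle r
    -- The approximation lies between this candidate and `x`, which share their first `n` terms;
    -- convexity does the rest.
    have h3 : AgreeBelow n (ofList (initialValues (a t) t)) x := fun i hi => by
      rw [initialValues_apply, if_pos (by omega)]
      exact ht i hi
    exact (AgreeBelow.of_le_of_le h1 h2 h3).symm.trans h3
  · ext n
    exact decide_eq_true_iff

/-! ### The priority construction. -/

/-- The data of one index: its current value, its rank, and a length. Rank `2 * e + 2` means that
the index follows the approximations number `e`, rank `2 * e + 1` that it did so and is now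
frozen. -/
abbrev Entry := List Bool × ℕ × ℕ

/-- The entry which never changes. -/
def baseEntry : Entry := ([], 0, 0)

/-- The rank of the followers which act at stage `s`. -/
def rank (s : ℕ) : ℕ := 2 * s.unpair.1 + 2

/-- The value to which the followers acting at stage `s` want to move. -/
noncomputable def target (s : ℕ) : List Bool := approx s.unpair.1 s

/-- The entry to be moved at stage `s`, a new one if there is none. -/
noncomputable def leader (s : ℕ) (l : List Entry) : Entry :=
  ((l.filter fun x => x.2.1 = rank s).head?).getD (target s, rank s, s)

/-- `y` lies between the value of `o` and the target. -/
def Crossed (s : ℕ) (o : Entry) (y : Entry) : Prop :=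
  ofList o.1 ≤ ofList y.1 ∧ ofList y.1 ≤ ofList (target s)

/-- `y` prevents the entry `o` from moving to the target. -/
def Blocks (s : ℕ) (o : Entry) (y : Entry) : Prop :=
  y.2.1 < rank s ∧ (Crossed s o y ∨
    (y.2.1 ≠ 0 ∧ y.2.1 % 2 = 0) ∧ AgreeBelow o.2.2 (ofList y.1) (ofList (target s)))

/-- The effect of a blocked move on other entries. -/
def freeze (s : ℕ) (y : Entry) : Entry :=
  if y.2.1 = rank s then (y.1, 2 * s.unpair.1 + 1, y.2.2) else y

open Classical in
/-- The effect of a successful move on other entries. -/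
noncomputable def advance (s : ℕ) (o y : Entry) : Entry :=
  if Crossed s o y then (target s, rank s, o.2.2) else y

open Classical in
/-- The construction at stage `s`. -/
noncomputable def step (s : ℕ) (l : List Entry) : List Entry :=
  if ∃ y ∈ l, Blocks s (leader s l) y then l.map (freeze s) ++ [baseEntry]
  else l.map (advance s (leader s l)) ++ [(target s, rank s, (leader s l).2.2)]

/-- The list of entries before stage `s`. -/
noncomputable def entries : ℕ → List Entry
  | 0 => [baseEntry]
  | s + 1 => step s (entries s)

/-- The entry of index `k` before stage `s`. -/
noncomputable def entry (s k : ℕ) : Entry := (entries s).getD k baseEntry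

/-! ### The construction is primitive recursive. -/

section Primrec

variable {γ : Type} [Primcodable γ]

theorem primrec_rank : Primrec rank :=
  Primrec.nat_add.comp (Primrec.nat_mul.comp (Primrec.const 2)
    (Primrec.fst.comp Primrec.unpair)) (Primrec.const 2)

theorem primrec_target : Primrec target :=
  primrec_approx.comp (Primrec.fst.comp Primrec.unpair) Primrec.id

theorem primrec_leader : Primrec₂ leader := by
  have hR : PrimrecRel fun (y : Entry) (s : ℕ) => y.2.1 = rank s :=
    Primrec.eq.comp (Primrec.fst.comp (Primrec.snd.comp Primrec.fst))
      (primrec_rank.comp Primrec.snd)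
  have hf : Primrec fun q : ℕ × List Entry => q.2.filter fun y => y.2.1 = rank q.1 :=
    hR.listFilter.comp Primrec.snd Primrec.fst
  exact Primrec.option_getD.comp (Primrec.list_head?.comp hf)
    ((primrec_target.comp Primrec.fst).pair ((primrec_rank.comp Primrec.fst).pair Primrec.fst))

theorem primrecPred_crossed {f : γ → ℕ} {g h : γ → Entry} (hf : Primrec f) (hg : Primrec g)
    (hh : Primrec h) : PrimrecPred fun c => Crossed (f c) (g c) (h c) :=
  (primrecRel_ofList_le.comp (Primrec.fst.comp hg) (Primrec.fst.comp hh)).and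
    (primrecRel_ofList_le.comp (Primrec.fst.comp hh) (primrec_target.comp hf))

theorem primrecPred_blocks {f : γ → ℕ} {g h : γ → Entry} (hf : Primrec f) (hg : Primrec g)
    (hh : Primrec h) : PrimrecPred fun c => Blocks (f c) (g c) (h c) := by
  have hr : Primrec fun c => (h c).2.1 := Primrec.fst.comp (Primrec.snd.comp hh)
  have hag : PrimrecPred fun c =>
      AgreeBelow (g c).2.2 (ofList (h c).1) (ofList (target (f c))) :=
    primrecPred_agreeBelow.comp (f := fun c => ((g c).2.2, (h c).1, target (f c)))
      ((Primrec.snd.comp (Primrec.snd.comp hg)).pair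
        ((Primrec.fst.comp hh).pair (primrec_target.comp hf)))
  exact (Primrec.nat_lt.comp hr (primrec_rank.comp hf)).and
    ((primrecPred_crossed hf hg hh).or
      (((Primrec.eq.comp hr (Primrec.const 0)).not.and
        (Primrec.eq.comp (Primrec.nat_mod.comp hr (Primrec.const 2)) (Primrec.const 0))).and hag))

theorem primrec_step : Primrec₂ step := by
  classical
  have hs : Primrec fun q : ℕ × List Entry => q.1 := Primrec.fst
  have hl : Primrec fun q : ℕ × List Entry => leader q.1 q.2 := primrec_leader
  have hb : PrimrecRel fun (y : Entry) (q : ℕ × List Entry) => Blocks q.1 (leader q.1 q.2) y :=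
    primrecPred_blocks (hs.comp Primrec.snd) (hl.comp Primrec.snd) Primrec.fst
  have hcond : PrimrecPred fun q : ℕ × List Entry => ∃ y ∈ q.2, Blocks q.1 (leader q.1 q.2) y :=
    hb.exists_mem_list.comp Primrec.snd Primrec.id
  have hfr : Primrec₂ fun (q : ℕ × List Entry) (y : Entry) => freeze q.1 y := by
    have h1 : Primrec fun p : (ℕ × List Entry) × Entry => p.1.1 := Primrec.fst.comp Primrec.fst
    have h2 : Primrec fun p : (ℕ × List Entry) × Entry => p.2 := Primrec.snd
    exact Primrec.ite (Primrec.eq.comp (Primrec.fst.comp (Primrec.snd.comp h2))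
      (primrec_rank.comp h1)) ((Primrec.fst.comp h2).pair ((Primrec.succ.comp
        (Primrec.nat_mul.comp (Primrec.const 2) (Primrec.fst.comp (Primrec.unpair.comp h1)))).pair
          (Primrec.snd.comp (Primrec.snd.comp h2)))) h2
  have hadv : Primrec₂ fun (q : ℕ × List Entry) (y : Entry) => advance q.1 (leader q.1 q.2) y :=
    Primrec.ite (primrecPred_crossed (hs.comp Primrec.fst) (hl.comp Primrec.fst) Primrec.snd)
      ((primrec_target.comp (hs.comp Primrec.fst)).pair
        ((primrec_rank.comp (hs.comp Primrec.fst)).pair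
          (Primrec.snd.comp (Primrec.snd.comp (hl.comp Primrec.fst))))) Primrec.snd
  exact Primrec.ite hcond
    (Primrec.list_concat.comp (Primrec.list_map Primrec.snd hfr) (Primrec.const baseEntry))
    (Primrec.list_concat.comp (Primrec.list_map Primrec.snd hadv)
      ((primrec_target.comp hs).pair ((primrec_rank.comp hs).pair
        (Primrec.snd.comp (Primrec.snd.comp hl)))))

theorem primrec_entries : Primrec entries := by
  have h : Primrec₂ fun (_ : Unit) (q : ℕ × List Entry) => step q.1 q.2 :=
    primrec_step.comp (Primrec.fst.comp Primrec.snd) (Primrec.snd.comp Primrec.snd)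
  have hrec := (Primrec.nat_rec (Primrec.const [baseEntry]) h).comp (Primrec.const ()) Primrec.id
  refine hrec.of_eq fun s => ?_
  induction s with
  | zero => rfl
  | succ s ih =>
    simp only [id] at ih ⊢
    rw [entries, ← ih]

theorem primrec_entry : Primrec₂ entry :=
  (Primrec.list_getD baseEntry).comp (primrec_entries.comp Primrec.fst) Primrec.snd

end Primrec

/-! ### The effect of one stage on the entries. -/

theorem length_entries (s : ℕ) : (entries s).length = s + 1 := by
  induction s with
  | zero => rfl
  | succ s ih =>
    rw [entries, step]
    split_ifs <;> simp [ih]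

theorem entry_of_lt {s k : ℕ} (h : s < k) : entry s k = baseEntry :=
  List.getD_eq_default _ _ (by rw [length_entries]; omega)

theorem mem_entries_iff {s : ℕ} {y : Entry} : y ∈ entries s ↔ ∃ k ≤ s, entry s k = y := by
  rw [List.mem_iff_getElem]
  constructor
  · rintro ⟨k, hk, rfl⟩
    refine ⟨k, ?_, List.getD_eq_getElem _ _ hk⟩
    rw [length_entries] at hk
    omega
  · rintro ⟨k, hk, rfl⟩
    have hk' : k < (entries s).length := by rw [length_entries]; omega
    exact ⟨k, hk', (List.getD_eq_getElem _ _ hk').symm⟩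

theorem getD_map_append {α : Type*} (l : List α) (f : α → α) (a d : α) (k : ℕ) (hd : f d = d) :
    (l.map f ++ [a]).getD k d = if k = l.length then a else f (l.getD k d) := by
  split_ifs with h
  · subst h
    simp [List.getD_eq_getElem?_getD]
  · rcases lt_or_gt_of_ne h with h | h
    · simp [List.getD_eq_getElem?_getD, List.getElem?_append_left, h]
    · rw [List.getD_eq_default, List.getD_eq_default _ _ h.le, hd]
      simpa using h

/-- A move that crossed index 0 would be blocked, since rank 0 is below every acting rank. -/
theorem entry_zero_right (s : ℕ) : entry s 0 = baseEntry := by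
  have hf : ∀ s, freeze s baseEntry = baseEntry := fun s => if_neg (by simp [baseEntry, rank])
  induction s with
  | zero => rfl
  | succ s ih =>
    have hlen := length_entries s
    have hmem : baseEntry ∈ entries s := mem_entries_iff.2 ⟨0, by omega, ih⟩
    rw [entry] at ih ⊢
    rw [entries, step]
    split_ifs with h
    · rw [getD_map_append _ _ _ _ _ (hf s), if_neg (by omega), ih, hf]
    · have ha : advance s (leader s (entries s)) baseEntry = baseEntry :=
        if_neg fun hc => h ⟨_, hmem, by simp [baseEntry, rank], Or.inl hc⟩
      rw [getD_map_append _ _ _ _ _ ha, if_neg (by omega), ih, ha]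

/-- The entry which is to be moved at stage `s`. -/
noncomputable def stageLeader (s : ℕ) : Entry := leader s (entries s)

/-- Stage `s` is blocked if some entry prevents the move. -/
def Blocked (s : ℕ) : Prop := ∃ k, Blocks s (stageLeader s) (entry s k)

theorem blocked_iff {s : ℕ} : Blocked s ↔ ∃ y ∈ entries s, Blocks s (leader s (entries s)) y := by
  constructor
  · rintro ⟨k, hk⟩
    rcases le_or_gt k s with h | h
    · exact ⟨_, mem_entries_iff.2 ⟨k, h, rfl⟩, hk⟩
    -- An index not yet in use has the default entry, which index 0 also has; so quantifying over
    -- all indices adds no blocker.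
    · refine ⟨_, mem_entries_iff.2 ⟨0, Nat.zero_le _, rfl⟩, ?_⟩
      rw [entry_zero_right]
      rwa [entry_of_lt h] at hk
  · rintro ⟨y, hy, hb⟩
    obtain ⟨k, -, rfl⟩ := mem_entries_iff.1 hy
    exact ⟨k, hb⟩

theorem entry_succ_of_blocked {s : ℕ} (h : Blocked s) (k : ℕ) :
    entry (s + 1) k = freeze s (entry s k) := by
  have hf : freeze s baseEntry = baseEntry := if_neg (by simp [baseEntry, rank])
  rw [entry, entries, step, if_pos (blocked_iff.1 h), getD_map_append _ _ _ _ _ hf]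
  split_ifs with hk
  · rw [length_entries] at hk
    rw [entry_of_lt (by omega), hf]
  · rfl

theorem not_crossed_of_rank_lt {s k : ℕ} (h : ¬ Blocked s) (hk : (entry s k).2.1 < rank s) :
    ¬ Crossed s (stageLeader s) (entry s k) :=
  fun hc => h ⟨k, hk, Or.inl hc⟩

theorem entry_succ_of_not_blocked {s k : ℕ} (h : ¬ Blocked s) (hk : k ≠ s + 1) :
    entry (s + 1) k = advance s (stageLeader s) (entry s k) := by
  have ha : advance s (leader s (entries s)) baseEntry = baseEntry := by
    have := not_crossed_of_rank_lt (k := 0) h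
    rw [entry_zero_right] at this
    exact if_neg (this (by simp [baseEntry, rank]))
  rw [entry, entries, step, if_neg (fun hc => h (blocked_iff.2 hc)),
    getD_map_append _ _ _ _ _ ha, if_neg (by rwa [length_entries])]
  rfl

theorem entry_succ_self_of_not_blocked {s : ℕ} (h : ¬ Blocked s) :
    entry (s + 1) (s + 1) = (target s, rank s, (stageLeader s).2.2) := by
  rw [entry, entries, step, if_neg (fun hc => h (blocked_iff.2 hc))]
  have := length_entries s
  simp [List.getD_eq_getElem?_getD, this, stageLeader]

/-- The approximations number `e` have a follower before stage `s`. -/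
def Active (e s : ℕ) : Prop := ∃ k, (entry s k).2.1 = 2 * e + 2

theorem stageLeader_of_active {s : ℕ} (h : Active s.unpair.1 s) :
    ∃ k, (entry s k).2.1 = rank s ∧ stageLeader s = entry s k := by
  obtain ⟨k, hk⟩ := h
  have hks : k ≤ s := by
    by_contra hc
    rw [entry_of_lt (by omega)] at hk
    simp [baseEntry] at hk
  have hmem : entry s k ∈ (entries s).filter fun x => x.2.1 = rank s := by
    rw [List.mem_filter]
    exact ⟨mem_entries_iff.2 ⟨k, hks, rfl⟩, decide_eq_true hk⟩
  obtain ⟨y, hy⟩ : ∃ y, ((entries s).filter fun x => x.2.1 = rank s).head? = some y := by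
    rw [← Option.isSome_iff_exists, List.isSome_head?]
    exact List.ne_nil_of_mem hmem
  have hy' := List.mem_filter.1 (List.mem_of_head? hy)
  obtain ⟨j, -, rfl⟩ := mem_entries_iff.1 hy'.1
  refine ⟨j, of_decide_eq_true hy'.2, ?_⟩
  rw [stageLeader, leader, hy]
  rfl

theorem stageLeader_of_not_active {s : ℕ} (h : ¬ Active s.unpair.1 s) :
    stageLeader s = (target s, rank s, s) := by
  have : (entries s).filter (fun x => x.2.1 = rank s) = [] := by
    rw [List.filter_eq_nil_iff]
    intro y hy hr
    obtain ⟨k, -, rfl⟩ := mem_entries_iff.1 hy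
    exact h ⟨k, of_decide_eq_true hr⟩
  rw [stageLeader, leader, this]
  rfl

/-! ### Values, ranks and the persistence of inequalities. -/

/-- The value of index `k` before stage `s`. -/
noncomputable def val (s k : ℕ) : LexSeq := ofList (entry s k).1

/-- The rank of index `k` before stage `s`. -/
noncomputable def rk (s k : ℕ) : ℕ := (entry s k).2.1

/-- Crossing an entry of smaller rank blocks the stage, whence `rank s ≤ rk s k` in the last case.
The stage-by-stage inductions below mostly split along these cases. -/
theorem transition (s k : ℕ) :
    (entry (s + 1) k = entry s k ∧ (Blocked s → rk s k ≠ rank s) ∧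
      (¬ Blocked s → ¬ Crossed s (stageLeader s) (entry s k))) ∨
    (Blocked s ∧ rk s k = rank s ∧
      entry (s + 1) k = ((entry s k).1, 2 * s.unpair.1 + 1, (entry s k).2.2)) ∨
    (¬ Blocked s ∧ (k = s + 1 ∨ Crossed s (stageLeader s) (entry s k) ∧ rank s ≤ rk s k) ∧
      entry (s + 1) k = (target s, rank s, (stageLeader s).2.2)) := by
  by_cases h : Blocked s
  · rw [entry_succ_of_blocked h, freeze]
    split_ifs with hr
    · exact Or.inr (Or.inl ⟨h, hr, rfl⟩)
    · exact Or.inl ⟨rfl, fun _ => hr, fun hn => absurd h hn⟩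
  · rcases eq_or_ne k (s + 1) with rfl | hk
    · exact Or.inr (Or.inr ⟨h, Or.inl rfl, entry_succ_self_of_not_blocked h⟩)
    · rw [entry_succ_of_not_blocked h hk, advance]
      split_ifs with hc
      · refine Or.inr (Or.inr ⟨h, Or.inr ⟨hc, ?_⟩, rfl⟩)
        by_contra hr
        exact not_crossed_of_rank_lt h (not_le.1 hr) hc
      · exact Or.inl ⟨rfl, fun hb => absurd hb h, fun _ => hc⟩

theorem entry_zero_left (k : ℕ) : entry 0 k = baseEntry := by
  rcases Nat.eq_zero_or_pos k with rfl | hk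
  exacts [entry_zero_right 0, entry_of_lt hk]

theorem rk_zero_left (k : ℕ) : rk 0 k = 0 := by rw [rk, entry_zero_left]; rfl

theorem val_le_approx {s k e : ℕ} (h : rk s k = 2 * e + 1 ∨ rk s k = 2 * e + 2) :
    val s k ≤ ofList (approx e s) := by
  induction s with
  | zero =>
    rw [rk_zero_left] at h
    omega
  | succ s ih =>
    have hm := approx_le_succ e s
    rw [rk] at h
    rw [val]
    rcases transition s k with ⟨he, -, -⟩ | ⟨-, hr, he⟩ | ⟨-, -, he⟩
    · rw [he] at h ⊢
      exact (ih h).trans hm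
    · rw [he] at h ⊢
      simp only [rank] at h hr
      exact (ih (by omega)).trans hm
    · rw [he] at h ⊢
      simp only [rank] at h
      obtain rfl : s.unpair.1 = e := by omega
      exact hm

theorem stageLeader_le_target (s : ℕ) : ofList (stageLeader s).1 ≤ ofList (target s) := by
  by_cases h : Active s.unpair.1 s
  · obtain ⟨k, hk, he⟩ := stageLeader_of_active h
    rw [he]
    exact val_le_approx (Or.inr hk)
  · rw [stageLeader_of_not_active h]

/-- A stage for `e` treats all its followers alike: they are frozen together or, all being crossed,
moved together with whatever else joins them. Other stages create no followers of `e`. -/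
theorem entry_eq_of_rk_eq {s k j e : ℕ} (hk : rk s k = 2 * e + 2) (hj : rk s j = 2 * e + 2) :
    entry s k = entry s j := by
  induction s generalizing k j e with
  | zero =>
    rw [rk_zero_left] at hk
    omega
  | succ s ih =>
    have hlead : ∀ i, rk s i = rank s → Crossed s (stageLeader s) (entry s i) := by
      intro i hi
      obtain ⟨i', hi', he⟩ := stageLeader_of_active ⟨i, hi⟩
      rw [Crossed, he, ih hi hi', ← he]
      exact ⟨le_rfl, stageLeader_le_target s⟩
    by_cases hes : s.unpair.1 = e
    · have key : ∀ i, rk (s + 1) i = 2 * e + 2 →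
          entry (s + 1) i = (target s, rank s, (stageLeader s).2.2) := by
        intro i hi
        rw [rk] at hi
        rcases transition s i with ⟨he, h1, h2⟩ | ⟨-, hr, he⟩ | ⟨-, -, he⟩
        · rw [he] at hi
          have hi' : rk s i = rank s := by rw [rk, hi, rank, hes]
          by_cases hb : Blocked s
          · exact absurd hi' (h1 hb)
          · exact absurd (hlead i hi') (h2 hb)
        · rw [he] at hi
          simp only at hi
          omega
        · exact he
      rw [key k hk, key j hj]
    · have key : ∀ i, rk (s + 1) i = 2 * e + 2 →
          entry (s + 1) i = entry s i ∧ rk s i = 2 * e + 2 := by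
        intro i hi
        rw [rk] at hi
        rcases transition s i with ⟨he, h1, h2⟩ | ⟨-, hr, he⟩ | ⟨-, -, he⟩
        · rw [he] at hi
          exact ⟨he, hi⟩
        · rw [he] at hi
          simp only at hi
          omega
        · rw [he] at hi
          simp only [rank] at hi
          omega
      rw [(key k hk).1, (key j hj).1]
      exact ih (key k hk).2 (key j hj).2

theorem stageLeader_eq_entry {s k : ℕ} (h : rk s k = rank s) : stageLeader s = entry s k := by
  obtain ⟨i, hi, he⟩ := stageLeader_of_active ⟨k, h⟩
  rw [he, entry_eq_of_rk_eq hi h]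

theorem crossed_of_rk_eq {s k : ℕ} (h : rk s k = rank s) :
    Crossed s (stageLeader s) (entry s k) := by
  rw [Crossed, ← stageLeader_eq_entry h]
  exact ⟨le_rfl, stageLeader_le_target s⟩

theorem entry_succ_of_rk_succ_eq {s k : ℕ} (h : rk (s + 1) k = rank s) :
    ¬ Blocked s ∧ entry (s + 1) k = (target s, rank s, (stageLeader s).2.2) := by
  rw [rk] at h
  rcases transition s k with ⟨he, h1, h2⟩ | ⟨-, hr, he⟩ | ⟨hb, -, he⟩
  · rw [he] at h
    by_cases hb : Blocked s
    · exact absurd h (h1 hb)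
    · exact absurd (crossed_of_rk_eq h) (h2 hb)
  · rw [he] at h
    simp only [rank] at h
    omega
  · exact ⟨hb, he⟩

theorem entry_succ_of_rk_succ_eq_of_ne {s k e : ℕ} (h : rk (s + 1) k = 2 * e + 2)
    (hes : s.unpair.1 ≠ e) : entry (s + 1) k = entry s k := by
  rw [rk] at h
  rcases transition s k with ⟨he, -, -⟩ | ⟨-, hr, he⟩ | ⟨-, -, he⟩
  · exact he
  · rw [he] at h
    simp only at h
    omega
  · rw [he] at h
    simp only [rank] at h
    omega

theorem not_active_succ_of_blocked {s : ℕ} (h : Blocked s) : ¬ Active s.unpair.1 (s + 1) :=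
  fun ⟨_, hk⟩ => (entry_succ_of_rk_succ_eq hk).1 h

theorem val_le_val_succ (s k : ℕ) : val s k ≤ val (s + 1) k := by
  rw [val, val]
  rcases transition s k with ⟨he, -, -⟩ | ⟨-, -, he⟩ | ⟨-, rfl | ⟨hc, -⟩, he⟩ <;> rw [he]
  · rw [entry_of_lt (by omega)]
    exact ofList_nil_le _
  · exact hc.2

theorem val_monotone (k : ℕ) : Monotone fun s => val s k :=
  monotone_nat_of_le_succ fun s => val_le_val_succ s k

theorem rk_succ_le {s k : ℕ} (h : k ≤ s) : rk (s + 1) k ≤ rk s k := by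
  rw [rk]
  rcases transition s k with ⟨he, -, -⟩ | ⟨-, hr, he⟩ | ⟨-, rfl | ⟨-, hr⟩, he⟩ <;> rw [he]
  · rfl
  · rw [hr, rank]
    simp
  · omega
  · exact hr

/-- A value crossed jumps to the target; a larger value is either crossed as well or already above
the target. The bounds on the indices exclude the index `s + 1`, which is placed at the target
without having been crossed. -/
theorem val_succ_le_val_succ {s i j : ℕ} (hi : i ≤ s) (hj : j ≤ s) (h : val s i ≤ val s j) :
    val (s + 1) i ≤ val (s + 1) j := by
  have key : ∀ k ≤ s, (val (s + 1) k = val s k ∧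
        (¬ Blocked s → ¬ Crossed s (stageLeader s) (entry s k))) ∨
      (¬ Blocked s ∧ Crossed s (stageLeader s) (entry s k) ∧
        val (s + 1) k = ofList (target s)) := by
    intro k hk
    rw [val, val]
    rcases transition s k with ⟨he, -, h2⟩ | ⟨hb, -, he⟩ | ⟨hb, rfl | ⟨hc, -⟩, he⟩
    · exact Or.inl ⟨by rw [he], h2⟩
    · exact Or.inl ⟨by rw [he], fun hn => absurd hb hn⟩
    · omega
    · exact Or.inr ⟨hb, hc, by rw [he]⟩
  rcases key i hi with ⟨ei, -⟩ | ⟨hb, ci, ei⟩ <;> rcases key j hj with ⟨ej, hj'⟩ | ⟨-, cj, ej⟩ <;>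
    rw [ei, ej]
  · exact h
  · exact h.trans cj.2
  · exact (not_le.1 fun hc => hj' hb ⟨ci.1.trans h, hc⟩).le

theorem val_le_val_of_le {s t i j : ℕ} (hi : i ≤ s) (hj : j ≤ s) (h : val s i ≤ val s j)
    (hst : s ≤ t) : val t i ≤ val t j := by
  induction t, hst using Nat.le_induction with
  | base => exact h
  | succ t ht ih => exact val_succ_le_val_succ (hi.trans ht) (hj.trans ht) ih

theorem exists_stage_ge (e N : ℕ) : ∃ s ≥ N, s.unpair.1 = e :=
  ⟨Nat.pair e N, Nat.right_le_pair e N, by simp⟩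

/-- The values of the followers of `e` are eventually late approximations. -/
theorem eventually_follower {e : ℕ} {Q : List Bool → Prop}
    (h : ∀ᶠ s in atTop, Q (approx e s)) :
    ∀ᶠ s in atTop, ∀ k, rk s k = 2 * e + 2 → Q (entry s k).1 := by
  obtain ⟨N, hN⟩ := eventually_atTop.1 h
  obtain ⟨t, ht, hte⟩ := exists_stage_ge e N
  have hact : ∀ s ≥ t, s.unpair.1 = e → ∀ k, rk (s + 1) k = 2 * e + 2 →
      Q (entry (s + 1) k).1 := by
    rintro s hs rfl k hk
    rw [(entry_succ_of_rk_succ_eq hk).2]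
    exact hN s (ht.trans hs)
  -- A stage for `e` leaves no follower of `e` with an old value; other stages do not change its
  -- followers.
  refine eventually_atTop.2 ⟨t + 1, fun s hs => ?_⟩
  induction s, hs using Nat.le_induction with
  | base => exact hact t le_rfl hte
  | succ s hs ih =>
    intro k hk
    by_cases hes : s.unpair.1 = e
    · exact hact s (by omega) hes k hk
    · have he := entry_succ_of_rk_succ_eq_of_ne hk hes
      rw [he]
      refine ih k ?_
      rwa [rk, he] at hk

/-! ### Final ranks and limits of values. -/

theorem exists_rk_stable (k : ℕ) : ∃ r, ∀ᶠ s in atTop, rk s k = r := by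
  have hanti : Antitone fun n => rk (k + n) k :=
    antitone_nat_of_succ_le fun n => rk_succ_le (Nat.le_add_right k n)
  obtain ⟨m, hm⟩ : ∃ m, ∀ n, rk (k + m) k ≤ rk (k + n) k :=
    ⟨_, fun n => Function.argmin_le (fun n => rk (k + n) k) n⟩
  refine ⟨rk (k + m) k, eventually_atTop.2 ⟨k + m, fun s hs => ?_⟩⟩
  obtain ⟨n, rfl⟩ := Nat.exists_eq_add_of_le hs
  rw [add_assoc]
  exact le_antisymm (hanti (Nat.le_add_right m n)) (hm _)

/-- Any change of an entry gives it a positive even rank or lowers an even rank to an odd one;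
neither fits a constant rank that is 0 or odd. -/
theorem eventually_entry_eq {k r : ℕ} (h : ∀ᶠ s in atTop, rk s k = r) (hr : r = 0 ∨ r % 2 = 1) :
    ∃ y, ∀ᶠ s in atTop, entry s k = y := by
  obtain ⟨N, hN⟩ := eventually_atTop.1 h
  refine ⟨entry N k, eventually_atTop.2 ⟨N, fun s hs => ?_⟩⟩
  induction s, hs using Nat.le_induction with
  | base => rfl
  | succ s hs ih =>
    have h1 := hN s hs
    have h2 := hN (s + 1) (by omega)
    rw [← ih]
    rcases transition s k with ⟨he, -, -⟩ | ⟨-, hr', he⟩ | ⟨-, -, he⟩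
    · exact he
    · simp only [rk, he, rank] at h1 h2 hr'
      omega
    · simp only [rk, he, rank] at h2
      omega

theorem eventually_length_eq {k e : ℕ} (h : ∀ᶠ s in atTop, rk s k = 2 * e + 2) :
    ∃ b, ∀ᶠ s in atTop, (entry s k).2.2 = b := by
  obtain ⟨N, hN⟩ := eventually_atTop.1 h
  refine ⟨(entry N k).2.2, eventually_atTop.2 ⟨N, fun s hs => ?_⟩⟩
  induction s, hs using Nat.le_induction with
  | base => rfl
  | succ s hs ih =>
    have h1 := hN s hs
    have h2 := hN (s + 1) (by omega)
    rw [← ih]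
    by_cases hes : s.unpair.1 = e
    · subst hes
      rw [(entry_succ_of_rk_succ_eq h2).2, stageLeader_eq_entry h1]
    · rw [entry_succ_of_rk_succ_eq_of_ne h2 hes]

/-- The limit of the approximations number `e`. -/
noncomputable def approxLimit (e : ℕ) : LexSeq := (exists_convergesTo (approx_monotone e)).choose

theorem approx_convergesTo (e : ℕ) :
    ConvergesTo (fun s => ofList (approx e s)) (approxLimit e) :=
  (exists_convergesTo (approx_monotone e)).choose_spec

/-- The limit of the values of index `k`. -/
noncomputable def valLimit (k : ℕ) : LexSeq := (exists_convergesTo (val_monotone k)).choose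

theorem val_convergesTo (k : ℕ) : ConvergesTo (fun s => val s k) (valLimit k) :=
  (exists_convergesTo (val_monotone k)).choose_spec

theorem eventually_follower_agreeBelow (e n : ℕ) :
    ∀ᶠ s in atTop, ∀ k, rk s k = 2 * e + 2 → AgreeBelow n (val s k) (approxLimit e) :=
  eventually_follower (Q := fun l => AgreeBelow n (ofList l) (approxLimit e))
    ((approx_convergesTo e).agreeBelow n)

theorem valLimit_eq_approxLimit {k e : ℕ} (h : ∀ᶠ s in atTop, rk s k = 2 * e + 2) :
    valLimit k = approxLimit e := by
  refine (val_convergesTo k).unique (convergesTo_of_agreeBelow fun n => ?_)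
  filter_upwards [h, eventually_follower_agreeBelow e n] with s h1 h2
  exact h2 k h1

/-- The length `b` attached to a permanent follower of `e` is eventually fixed. With equal limits,
the follower of `d` would eventually agree with the target below `b` and block `e`, which then loses
all its followers. -/
theorem approxLimit_ne_of_followers {i j d e : ℕ} (hi : ∀ᶠ s in atTop, rk s i = 2 * d + 2)
    (hj : ∀ᶠ s in atTop, rk s j = 2 * e + 2) (hde : d < e) : approxLimit d ≠ approxLimit e := by
  intro heq
  obtain ⟨b, hb⟩ := eventually_length_eq hj
  have hev := (hi.and (hj.and (hb.and ((eventually_follower_agreeBelow d b).and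
    ((approx_convergesTo e).agreeBelow b)))))
  obtain ⟨N, hN⟩ := eventually_atTop.1 hev
  obtain ⟨s, hs, rfl⟩ := exists_stage_ge e N
  obtain ⟨h1, h2, h3, h4, h5⟩ := hN s hs
  have hbl : Blocked s := by
    refine ⟨i, ?_, Or.inr ⟨?_, ?_⟩⟩
    · change rk s i < _
      rw [h1, rank]
      omega
    · change rk s i ≠ 0 ∧ rk s i % 2 = 0
      omega
    · rw [stageLeader_eq_entry h2, h3]
      exact (h4 i h1).trans (heq ▸ h5.symm)
  exact not_active_succ_of_blocked hbl ⟨j, (hN (s + 1) (by omega)).2.1⟩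

theorem rk_cases (r : ℕ) : (r = 0 ∨ r % 2 = 1) ∨ ∃ e, r = 2 * e + 2 := by
  by_cases h : r = 0 ∨ r % 2 = 1
  · exact Or.inl h
  · exact Or.inr ⟨r / 2 - 1, by omega⟩

theorem frozen_limit {k : ℕ} {y : Entry} (hy : ∀ᶠ s in atTop, entry s k = y) :
    valLimit k = ofList y.1 ∧ ∀ᶠ s in atTop, val s k = ofList y.1 := by
  have : ∀ᶠ s in atTop, val s k = ofList y.1 := hy.mono fun s hs => by rw [val, hs]
  exact ⟨(val_convergesTo k).eq_of_eventually_eq this, this⟩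

/-! ### Comparing limits at a finite stage. -/

/-- Indices with the same limit eventually have the same values. -/
theorem eventually_val_eq {i j : ℕ} (h : valLimit i = valLimit j) :
    ∀ᶠ s in atTop, val s i = val s j := by
  have reach : ∀ {i j : ℕ} {y : Entry}, valLimit i = valLimit j →
      (∀ᶠ s in atTop, entry s j = y) → ∀ᶠ s in atTop, val s i = val s j := by
    intro i j y h hy
    obtain ⟨h1, h2⟩ := frozen_limit hy
    have hc := val_convergesTo i
    rw [h, h1] at hc
    filter_upwards [h2, hc.eventually_eq_ofList (val_monotone i)] with s h3 h4
    rw [h3, h4]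
  obtain ⟨p, hp⟩ := exists_rk_stable i
  obtain ⟨q, hq⟩ := exists_rk_stable j
  rcases rk_cases q with hq' | ⟨e, rfl⟩
  · obtain ⟨y, hy⟩ := eventually_entry_eq hq hq'
    exact reach h hy
  rcases rk_cases p with hp' | ⟨d, rfl⟩
  · obtain ⟨y, hy⟩ := eventually_entry_eq hp hp'
    exact (reach h.symm hy).mono fun s hs => hs.symm
  rw [valLimit_eq_approxLimit hp, valLimit_eq_approxLimit hq] at h
  rcases lt_trichotomy d e with hde | rfl | hde
  · exact absurd h (approxLimit_ne_of_followers hp hq hde)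
  · filter_upwards [hp, hq] with s h1 h2
    rw [val, val, entry_eq_of_rk_eq h1 h2]
  · exact absurd h.symm (approxLimit_ne_of_followers hq hp hde)

theorem valLimit_le_iff {i j : ℕ} :
    valLimit i ≤ valLimit j ↔ ∃ s, i ≤ s ∧ j ≤ s ∧ val s i ≤ val s j := by
  constructor
  · intro h
    by_contra hc
    push Not at hc
    have hge : ∀ᶠ s in atTop, val s j < val s i := by
      filter_upwards [eventually_ge_atTop i, eventually_ge_atTop j] with s h1 h2
      exact hc s h1 h2
    -- A strict inequality the wrong way at all late stages forces equal limits, hence eventually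
    -- equal values.
    have heq := le_antisymm h
      ((val_convergesTo j).le (val_convergesTo i) (hge.mono fun _ => le_of_lt))
    obtain ⟨s, h1, h2⟩ := (hge.and (eventually_val_eq heq)).exists
    exact absurd h2 h1.ne'
  · rintro ⟨s, hi, hj, h⟩
    exact (val_convergesTo i).le (val_convergesTo j)
      ((eventually_ge_atTop s).mono fun t ht => val_le_val_of_le hi hj h ht)

/-! ### Universality. -/

theorem frozen_lt_follower {s i j e : ℕ} (hi : rk s i = 2 * e + 1) (hj : rk s j = 2 * e + 2) :
    val s i < val s j := by
  induction s with
  | zero =>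
    rw [rk_zero_left] at hi
    omega
  | succ s ih =>
    by_cases hes : s.unpair.1 = e
    · subst hes
      obtain ⟨hb, hej⟩ := entry_succ_of_rk_succ_eq hj
      have hei : entry (s + 1) i = entry s i ∧ ¬ Crossed s (stageLeader s) (entry s i) := by
        rw [rk] at hi
        rcases transition s i with ⟨he, -, h2⟩ | ⟨h2, -, -⟩ | ⟨-, -, he⟩
        · exact ⟨he, h2 hb⟩
        · exact absurd h2 hb
        · rw [he] at hi
          simp only [rank] at hi
          omega
      have hi' : rk s i = 2 * s.unpair.1 + 1 := by rwa [rk, hei.1] at hi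
      have hle : val s i ≤ ofList (target s) := val_le_approx (Or.inl hi')
      rw [val, val, hei.1, hej]
      -- A frozen value equal to the target would have been crossed, as the leader starts at or
      -- below the target.
      refine lt_of_le_of_ne hle fun heq => hei.2 ⟨?_, hle⟩
      exact heq ▸ stageLeader_le_target s
    · have hej := entry_succ_of_rk_succ_eq_of_ne hj hes
      rw [rk, hej] at hj
      rw [rk] at hi
      rcases transition s i with ⟨he, -, -⟩ | ⟨-, -, he⟩ | ⟨-, -, he⟩
      · rw [val, val, hej, he]
        rw [he] at hi
        exact ih hi hj
      · rw [he] at hi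
        simp only at hi
        omega
      · rw [he] at hi
        simp only [rank] at hi
        omega

theorem eq_baseEntry_of_rk_eq_zero {s k : ℕ} (h : rk s k = 0) : entry s k = baseEntry := by
  induction s with
  | zero => exact entry_zero_left k
  | succ s ih =>
    rw [rk] at h
    rcases transition s k with ⟨he, -, -⟩ | ⟨-, -, he⟩ | ⟨-, -, he⟩
    · rw [he] at h ⊢
      exact ih h
    · simp [he] at h
    · simp [he, rank] at h

/-- A point below the limit is eventually below the start of every move for `e`; a point above the
limit is never reached by a target. -/
theorem eventually_not_crossed {e : ℕ} {x : LexSeq} (hx : x ≠ approxLimit e) :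
    ∀ᶠ s in atTop, s.unpair.1 = e →
      ¬ (ofList (stageLeader s).1 ≤ x ∧ x ≤ ofList (target s)) := by
  rcases lt_or_gt_of_ne hx with hlt | hlt
  · have hev := (approx_convergesTo e).eventually_lt hlt
    filter_upwards [hev, eventually_follower (Q := fun l => x < ofList l) hev] with s h1 h2 hs
    rintro ⟨h3, -⟩
    refine absurd h3 (not_le.2 ?_)
    subst hs
    by_cases ha : Active s.unpair.1 s
    · obtain ⟨k, hk, he⟩ := stageLeader_of_active ha
      rw [he]
      exact h2 k hk
    · rw [stageLeader_of_not_active ha]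
      exact h1
  · refine Eventually.of_forall fun s hs hc => ?_
    subst hs
    exact absurd (hc.2.trans ((approx_convergesTo _).le_limit (approx_monotone _) s))
      (not_le.2 hlt)

theorem eventually_not_crossed_of_valLimit_ne {e k : ℕ} (h : valLimit k ≠ approxLimit e) :
    ∀ᶠ s in atTop, s.unpair.1 = e → (rk s k = 0 ∨ rk s k % 2 = 1) →
      ¬ Crossed s (stageLeader s) (entry s k) := by
  obtain ⟨r, hr⟩ := exists_rk_stable k
  by_cases hr' : r = 0 ∨ r % 2 = 1
  · obtain ⟨y, hy⟩ := eventually_entry_eq hr hr'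
    rw [(frozen_limit hy).1] at h
    filter_upwards [hy, eventually_not_crossed h] with s h1 h2 hs _
    rw [h1]
    exact h2 hs
  -- If the final rank is positive and even, the assumption on `rk s k` eventually fails.
  · filter_upwards [hr] with s h1 _ h2
    exact absurd (h1 ▸ h2) hr'

theorem stageLeader_agreeBelow {s n : ℕ} {x : LexSeq}
    (h1 : AgreeBelow n (ofList (target s)) x)
    (h2 : ∀ k, rk s k = rank s → AgreeBelow n (val s k) x) :
    AgreeBelow n (ofList (stageLeader s).1) x := by
  by_cases ha : Active s.unpair.1 s
  · obtain ⟨k, hk, he⟩ := stageLeader_of_active ha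
    rw [he]
    exact h2 k hk
  · rw [stageLeader_of_not_active ha]
    exact h1

theorem agreeBelow_of_crossed {s k n : ℕ} {x : LexSeq}
    (h1 : AgreeBelow n (ofList (target s)) x)
    (h2 : ∀ k, rk s k = rank s → AgreeBelow n (val s k) x)
    (hc : Crossed s (stageLeader s) (entry s k)) : AgreeBelow n (val s k) x := by
  have h3 := stageLeader_agreeBelow h1 h2
  exact (AgreeBelow.of_le_of_le hc.1 hc.2 (h3.trans h1.symm)).symm.trans h3

/-- From stage `N` on, the first `n` terms of the approximations number `d ≤ e` and of their
followers are final, and they distinguish the limits for `d < e` from the limit for `e`. -/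
structure Settled (e n N : ℕ) : Prop where
  le : n ≤ N
  ne : ∀ d < e, ¬ AgreeBelow n (approxLimit d) (approxLimit e)
  approx : ∀ s ≥ N, ∀ d ≤ e, AgreeBelow n (ofList (approx d s)) (approxLimit d)
  follower : ∀ s ≥ N, ∀ d ≤ e, ∀ k, rk s k = 2 * d + 2 → AgreeBelow n (val s k) (approxLimit d)

theorem exists_settled {e : ℕ} (h : ∀ d < e, approxLimit d ≠ approxLimit e) :
    ∃ n N, Settled e n N := by
  have h1 : ∀ d, ∃ m, d < e → ¬ AgreeBelow m (approxLimit d) (approxLimit e) := by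
    intro d
    by_contra! hc
    have hd := (hc 0).1
    refine h d hd (funext fun i => (hc (i + 1)).2 i (by omega))
  choose m hm using h1
  obtain ⟨n, hn⟩ : ∃ n, ∀ d < e, m d ≤ n :=
    ⟨(Finset.range e).sup m, fun d hd => Finset.le_sup (Finset.mem_range.2 hd)⟩
  have h2 : ∀ᶠ s in atTop, ∀ d ∈ Set.Iic e, AgreeBelow n (ofList (approx d s)) (approxLimit d) ∧
      ∀ k, rk s k = 2 * d + 2 → AgreeBelow n (val s k) (approxLimit d) :=
    (eventually_all_finite (Set.finite_Iic e)).2 fun d _ =>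
      ((approx_convergesTo d).agreeBelow n).and (eventually_follower_agreeBelow d n)
  obtain ⟨N, hN⟩ := eventually_atTop.1 h2
  exact ⟨n, max n N, le_max_left _ _, fun d hd hag => hm d hd (hag.mono (hn d hd)),
    fun s hs d hd => (hN s ((le_max_right _ _).trans hs) d hd).1,
    fun s hs d hd => (hN s ((le_max_right _ _).trans hs) d hd).2⟩

namespace Settled

variable {e n N : ℕ}

theorem agreeBelow_of_crossed (h : Settled e n N) {s k : ℕ} (hs : N ≤ s) (hse : s.unpair.1 ≤ e)
    (hc : Crossed s (stageLeader s) (entry s k)) :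
    AgreeBelow n (val s k) (approxLimit s.unpair.1) :=
  LeftRE.agreeBelow_of_crossed (h.approx s hs _ hse) (h.follower s hs _ hse) hc

/-- Late frozen entries of smaller rank do not agree with the limit for `e`. -/
theorem index_le_of_frozen (h : Settled e n N) {s k d : ℕ} (hs : N ≤ s) (hd : d < e)
    (hk : rk s k = 2 * d + 1) (hag : AgreeBelow n (val s k) (approxLimit e)) : k ≤ N := by
  induction s, hs using Nat.le_induction with
  | base =>
    by_contra hc
    rw [rk, entry_of_lt (by omega)] at hk
    simp [baseEntry] at hk
  | succ s hs ih =>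
    rw [rk] at hk
    rw [val] at hag
    rcases transition s k with ⟨he, -, -⟩ | ⟨-, hr, he⟩ | ⟨-, -, he⟩
    · rw [he] at hk hag
      exact ih hk hag
    · rw [he] at hk hag
      simp only at hk
      obtain rfl : s.unpair.1 = d := by omega
      -- An entry frozen at this stage was a follower of `d`, so its prefix is that of the limit for
      -- `d`, not that for `e`.
      exact absurd ((h.follower s hs _ hd.le k hr).symm.trans hag) (h.ne _ hd)
    · rw [he] at hk
      simp only [rank] at hk
      omega

/-- A move for a smaller `d` takes place among sequences with the prefix of its own limit, so it
cannot capture a follower of `e`. -/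
theorem rk_succ_of_follower (h : Settled e n N) {s k : ℕ} (hs : N ≤ s)
    (hk : rk s k = 2 * e + 2) : rk (s + 1) k = 2 * e + 2 ∨ (s.unpair.1 = e ∧ Blocked s) := by
  rw [rk]
  rcases transition s k with ⟨he, -, -⟩ | ⟨hb, hr, -⟩ | ⟨-, hc, he⟩
  · rw [he]
    exact Or.inl hk
  · rw [rank] at hr
    exact Or.inr ⟨by omega, hb⟩
  · rcases hc with rfl | ⟨hc, hr⟩
    · rw [rk, entry_of_lt (by omega)] at hk
      simp [baseEntry] at hk
    · rw [rank] at hr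
      rcases Nat.lt_or_ge s.unpair.1 e with hlt | hge
      · exact absurd ((h.agreeBelow_of_crossed hs hlt.le hc).symm.trans
          (h.follower s hs e le_rfl k hk)) (h.ne _ hlt)
      · rw [he, rank]
        left
        simp only
        omega

/-- Late moves for `e` are blocked only by frozen entries of `e`, or if the length is small. -/
theorem eventually_blocks (h : Settled e n N) (hne : ∀ k, valLimit k ≠ approxLimit e) :
    ∀ᶠ s in atTop, s.unpair.1 = e → ∀ k, Blocks s (stageLeader s) (entry s k) →
      (stageLeader s).2.2 < n ∨
        (rk s k = 2 * e + 1 ∧ Crossed s (stageLeader s) (entry s k)) := by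
  have hev := (eventually_all_finite (Set.finite_Iic N)).2 fun k _ =>
    eventually_not_crossed_of_valLimit_ne (hne k)
  filter_upwards [hev, eventually_ge_atTop N] with s h1 hs hse k hb
  subst hse
  obtain ⟨hlt, hb⟩ := hb
  change rk s k < rank s at hlt
  rw [rank] at hlt
  have heven : ∀ d < s.unpair.1, rk s k = 2 * d + 2 →
      ¬ AgreeBelow n (val s k) (approxLimit s.unpair.1) := fun d hd hk hag =>
    h.ne d hd ((h.follower s hs d hd.le k hk).symm.trans hag)
  rcases hb with hc | ⟨hr, hag⟩
  · have hag := h.agreeBelow_of_crossed hs le_rfl hc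
    rcases rk_cases (rk s k) with (h0 | hodd) | ⟨d, hd⟩
    · rw [eq_baseEntry_of_rk_eq_zero h0, ← entry_zero_right s] at hc
      exact absurd hc (h1 0 (Nat.zero_le N) rfl (Or.inl (by rw [rk, entry_zero_right]; rfl)))
    · by_cases hown : rk s k = 2 * s.unpair.1 + 1
      · exact Or.inr ⟨hown, hc⟩
      · have hkN : k ≤ N := h.index_le_of_frozen (d := rk s k / 2) hs (by omega) (by omega) hag
        exact absurd hc (h1 k hkN rfl (Or.inr hodd))
    · exact absurd hag (heven d (by omega) hd)
  · change rk s k ≠ 0 ∧ rk s k % 2 = 0 at hr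
    left
    by_contra hc
    exact heven (rk s k / 2 - 1) (by omega) (by omega)
      ((hag.mono (not_lt.1 hc)).trans (h.approx s hs _ le_rfl))

end Settled

theorem exists_valLimit_eq_of_minimal {e : ℕ} (hmin : ∀ d < e, approxLimit d ≠ approxLimit e) :
    ∃ k, valLimit k = approxLimit e := by
  by_contra! hne
  obtain ⟨n, N, h⟩ := exists_settled hmin
  obtain ⟨N', hN'⟩ := eventually_atTop.1
    ((h.eventually_blocks hne).and (eventually_ge_atTop N))
  have hperm : ∀ k s₀, ¬ ∀ s ≥ s₀, rk s k = 2 * e + 2 := fun k s₀ hk =>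
    hne k (valLimit_eq_approxLimit (eventually_atTop.2 ⟨s₀, hk⟩))
  -- If `e` were active at all late stages, its stages would never be blocked, and one follower
  -- would be permanent.
  obtain ⟨t, ht, hinact⟩ : ∃ t ≥ N', ¬ Active e t := by
    by_contra! hact
    obtain ⟨k, hk⟩ := hact N' le_rfl
    refine hperm k N' fun s hs => ?_
    induction s, hs using Nat.le_induction with
    | base => exact hk
    | succ s hs ih =>
      rcases h.rk_succ_of_follower (hN' s hs).2 ih with h1 | ⟨rfl, hb⟩
      · exact h1
      · exact absurd (hact (s + 1) (by omega)) (not_active_succ_of_blocked hb)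
  have hnt : n ≤ t := h.le.trans (hN' t ht).2
  -- With no follower at `t`, all later ones descend from a fresh leader, whose length is the stage
  -- of its creation.
  have hlen : ∀ s ≥ t, ∀ k, rk s k = 2 * e + 2 → t ≤ (entry s k).2.2 := by
    intro s hs
    induction s, hs using Nat.le_induction with
    | base => exact fun k hk => absurd ⟨k, hk⟩ hinact
    | succ s hs ih =>
      intro k hk
      by_cases hes : s.unpair.1 = e
      · subst hes
        rw [(entry_succ_of_rk_succ_eq hk).2]
        by_cases ha : Active s.unpair.1 s
        · obtain ⟨j, hj, he⟩ := stageLeader_of_active ha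
          rw [he]
          exact ih j hj
        · rw [stageLeader_of_not_active ha]
          exact hs
      · have he := entry_succ_of_rk_succ_eq_of_ne hk hes
        rw [rk, he] at hk
        rw [he]
        exact ih k hk
  -- A follower after `t` could not be blocked: its length is at least `n`, and the frozen entries
  -- of `e` lie strictly below it. It would be permanent.
  have hinact' : ∀ s ≥ t, ¬ Active e s := by
    rintro s hs ⟨k, hk⟩
    refine hperm k s fun r hr => ?_
    induction r, hr using Nat.le_induction with
    | base => exact hk
    | succ r hr ih =>
      have hrN := hN' r (ht.trans (hs.trans hr))
      rcases h.rk_succ_of_follower hrN.2 ih with h1 | ⟨hre, j, hj⟩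
      · exact h1
      · have hlead : stageLeader r = entry r k := stageLeader_eq_entry (by rw [ih, rank, hre])
        rcases hrN.1 hre j hj with h1 | ⟨h1, h2⟩
        · have := hlen r (hs.trans hr) k ih
          rw [hlead] at h1
          omega
        · rw [hlead] at h2
          exact absurd h2.1 (not_le.2 (frozen_lt_follower h1 ih))
  have hfrozen : ∀ s ≥ t, ∀ k, rk s k = 2 * e + 1 → k ≤ t := by
    intro s hs k
    induction s, hs using Nat.le_induction with
    | base =>
      intro hk
      by_contra hc
      rw [rk, entry_of_lt (by omega)] at hk
      simp [baseEntry] at hk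
    | succ s hs ih =>
      intro hk
      rw [rk] at hk
      rcases transition s k with ⟨he, -, -⟩ | ⟨-, hr, he⟩ | ⟨-, -, he⟩
      · rw [he] at hk
        exact ih hk
      · rw [he] at hk
        simp only at hk
        exact absurd ⟨k, by rw [← rk, hr, rank]; omega⟩ (hinact' s hs)
      · rw [he] at hk
        simp only [rank] at hk
        omega
  -- Only the finitely many indices up to `t` can be frozen entries of `e`, and none of them has the
  -- limit for `e`; so late moves cross none of them.
  obtain ⟨M, hM⟩ := eventually_atTop.1 ((eventually_all_finite (Set.finite_Iic t)).2 fun k _ =>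
    eventually_not_crossed_of_valLimit_ne (hne k))
  obtain ⟨s, hs, rfl⟩ := exists_stage_ge e (max t M)
  have hts : t ≤ s := (le_max_left _ _).trans hs
  by_cases hb : Blocked s
  · obtain ⟨k, hk⟩ := hb
    rcases (hN' s (ht.trans hts)).1 rfl k hk with h1 | ⟨h1, h2⟩
    · rw [stageLeader_of_not_active (hinact' s hts)] at h1
      simp only at h1
      omega
    · exact hM s ((le_max_right _ _).trans hs) k (hfrozen s hts k h1) rfl
        (Or.inr (by omega)) h2
  · refine hinact' (s + 1) (by omega) ⟨s + 1, ?_⟩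
    rw [entry_succ_self_of_not_blocked hb]
    rfl

theorem exists_valLimit_eq (e : ℕ) : ∃ k, valLimit k = approxLimit e := by
  classical
  have hex : ∃ d, approxLimit d = approxLimit e := ⟨e, rfl⟩
  obtain ⟨k, hk⟩ := exists_valLimit_eq_of_minimal (e := Nat.find hex) fun d hd heq =>
    Nat.find_min hex hd (heq.trans (Nat.find_spec hex))
  exact ⟨k, hk.trans (Nat.find_spec hex)⟩

/-! ### The order of the limits is r.e. -/

theorem rePred_exists_of_primrecRel {α : Type*} [Primcodable α] {R : α → ℕ → Prop}
    (h : PrimrecRel R) : REPred fun a => ∃ s, R a s := by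
  classical
  have hd : Computable₂ fun a s => decide (R a s) := h.decide.to_comp
  refine (Partrec.rfind hd.partrec₂).dom_re.of_eq fun a => ?_
  simp [Nat.rfind_dom]

end LeftRE

open LeftRE LexSeq in
theorem mainTheorem12 :
    ∃ α : ℕ → Set ℕ, IsUniversalLeftRENumbering α ∧ REPred (fun p : ℕ × ℕ => p ∈ LEX α) := by
  refine ⟨fun k => {n | valLimit k n = true}, ⟨⟨fun e s n => val s e n, ?_, ?_, ?_⟩, ?_⟩, ?_⟩
  · have h1 : Primrec fun p : ℕ × ℕ × ℕ => (entry p.2.1 p.1).1 :=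
      Primrec.fst.comp (primrec_entry.comp (Primrec.fst.comp Primrec.snd) Primrec.fst)
    exact (primrec_getD.comp h1 (Primrec.snd.comp Primrec.snd)).to_comp
  · exact fun e s => lexLE_iff.2 (val_le_val_succ s e)
  · intro e n
    filter_upwards [val_convergesTo e n] with s hs
    rw [hs]
  · intro A hA
    obtain ⟨e, x, hx, rfl⟩ := exists_approx_convergesTo hA
    obtain ⟨k, hk⟩ := exists_valLimit_eq e
    exact ⟨k, congrArg (fun y : LexSeq => {n | y n = true})
      (hk.trans ((approx_convergesTo e).unique hx))⟩
  · have hv : ∀ {f : (ℕ × ℕ) × ℕ → ℕ}, Primrec f → Primrec fun q => (entry q.2 (f q)).1 :=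
      fun hf => Primrec.fst.comp (primrec_entry.comp Primrec.snd hf)
    have hi : Primrec fun q : (ℕ × ℕ) × ℕ => q.1.1 := Primrec.fst.comp Primrec.fst
    have hj : Primrec fun q : (ℕ × ℕ) × ℕ => q.1.2 := Primrec.snd.comp Primrec.fst
    have hR : PrimrecRel fun (p : ℕ × ℕ) (s : ℕ) =>
        p.1 ≤ s ∧ p.2 ≤ s ∧ val s p.1 ≤ val s p.2 :=
      (Primrec.nat_le.comp hi Primrec.snd).and ((Primrec.nat_le.comp hj Primrec.snd).and
        (primrecRel_ofList_le.comp (hv hi) (hv hj)))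
    exact (rePred_exists_of_primrecRel hR).of_eq fun p =>
      valLimit_le_iff.symm.trans lexLE_iff.symm
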